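/- All graphs are finite and simple. A graph is planar if it can be drawn in the plane without crossings (vertices as distinct points, edges as simple continuous arcs between their endpoints whose interiors contain no vertex and are pairwise disjoint). A linear embedding of a graph $G=(V,E)$ is a pair $(\prec,\mathcal P)$ of a total ordering $\prec$ of $V$ and a partition $\mathcal P$ of $E$ into nonempty sets, called pages. A set of edges is crossing-free if it contains no two edges $uv$, $xy$ with $u\prec x\prec v\prec y$. The local page number $\operatorname{pn}_\ell(G)$ is the smallest $k$ for which $G$ has a linear embedding in which every page is crossing-free and every vertex has incident edges on at most $k$ pages. The union page number $\operatorname{pn}_u(G)$ is the smallest $k$ for which $G$ has a linear embedding with exactly $k$ pages such that, for each page $P$, every connected component of the graph formed by the edges of $P$ has a crossing-free edge set. For every planar graph $G$ we have $\operatorname{pn}_\ell(G)\le 4$ and $\operatorname{pn}_u(G)\le 5$. -/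

import Mathlib

/-- A drawing of the graph `G` in the Euclidean plane without crossings: distinct vertices are
distinct points, every edge is a simple continuous arc joining the points of its two endpoints,
the interior of an arc contains no vertex, and the interiors of distinct arcs are disjoint. -/
structure PlaneDrawing {V : Type*} (G : SimpleGraph V) where
  /-- the point at which a vertex is drawn -/
  point : V → EuclideanSpace ℝ (Fin 2)
  /-- the arc along which an edge is drawn -/
  arc : G.edgeSet → unitInterval → EuclideanSpace ℝ (Fin 2)
  point_injective : Function.Injective point
  arc_continuous : ∀ e, Continuous (arc e)
  arc_injective : ∀ e, Function.Injective (arc e)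
  arc_endpoints : ∀ e, s(arc e 0, arc e 1) = Sym2.map point e.1
  arc_ne_point : ∀ e, ∀ t ∈ Set.Ioo (0 : unitInterval) 1, ∀ v, arc e t ≠ point v
  arc_ne_arc : ∀ e f, e ≠ f → ∀ s ∈ Set.Ioo (0 : unitInterval) 1,
    ∀ t ∈ Set.Ioo (0 : unitInterval) 1, arc e s ≠ arc f t

/-- A graph is planar if it can be drawn in the plane without crossings. -/
def IsPlanar {V : Type*} (G : SimpleGraph V) : Prop :=
  Nonempty (PlaneDrawing G)

/-- A linear embedding of `G`: a linear ordering of the vertices (the spine ordering) and a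
partition of the edge set into finitely many nonempty parts (the pages). -/
structure LinearEmbedding {V : Type*} (G : SimpleGraph V) where
  /-- the spine ordering -/
  spine : LinearOrder V
  /-- the partition of the edges into pages -/
  pages : Finpartition (G.edgeSet : Set (Sym2 V))

/-- No two edges `uv`, `xy` in the set `F` cross, i.e. satisfy `u ≺ x ≺ v ≺ y`. -/
def CrossingFree {V : Type*} (spine : LinearOrder V) (F : Set (Sym2 V)) : Prop :=
  ∀ u v x y : V, s(u, v) ∈ F → s(x, y) ∈ F →
    ¬ (spine.lt u x ∧ spine.lt x v ∧ spine.lt v y)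

/-- The edges in `F` of a connected component `C` of the graph with edge set `F`.
(The graph is taken on all of `V`; a vertex without incident edge in `F` is a component
without edges.) -/
def componentEdges {V : Type*} (F : Set (Sym2 V))
    (C : (SimpleGraph.fromEdgeSet F).ConnectedComponent) : Set (Sym2 V) :=
  {e ∈ F | ∀ v ∈ e, v ∈ C.supp}

namespace LinearEmbedding

variable {V : Type*} {G : SimpleGraph V}

/-- A book embedding: every page is crossing-free. -/
def IsBookEmbedding (L : LinearEmbedding G) : Prop :=
  ∀ P ∈ L.pages.parts, CrossingFree L.spine P

/-- The set of pages that contain at least one edge incident to `v`. -/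
def pagesAt (L : LinearEmbedding G) (v : V) : Set (Set (Sym2 V)) :=
  {P | P ∈ L.pages.parts ∧ ∃ e ∈ P, v ∈ e}

/-- Every vertex has incident edges on at most `k` pages. -/
def IsLocal (L : LinearEmbedding G) (k : ℕ) : Prop :=
  ∀ v, (L.pagesAt v).encard ≤ k

/-- A union embedding: every connected component of every page is crossing-free. -/
def IsUnionEmbedding (L : LinearEmbedding G) : Prop :=
  ∀ P ∈ L.pages.parts, ∀ C : (SimpleGraph.fromEdgeSet P).ConnectedComponent,
    CrossingFree L.spine (componentEdges P C)

end LinearEmbedding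

/-- The local page number: the smallest `k` such that `G` has a `k`-local book embedding
(`⊤` if there is no such `k`). -/
noncomputable def localPageNumber {V : Type*} (G : SimpleGraph V) : ℕ∞ :=
  ⨅ k ∈ {k : ℕ | ∃ L : LinearEmbedding G, L.IsBookEmbedding ∧ L.IsLocal k}, (k : ℕ∞)

/-- The union page number: the smallest `k` such that `G` has a union embedding with exactly `k`
pages (`⊤` if there is no such `k`). -/
noncomputable def unionPageNumber {V : Type*} (G : SimpleGraph V) : ℕ∞ :=
  ⨅ k ∈ {k : ℕ | ∃ L : LinearEmbedding G, L.IsUnionEmbedding ∧ L.pages.parts.card = k}, (k : ℕ∞)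

/-! A planar graph is a union of three forests, and three forests give both bounds. Let every vertex
have at most one parent in each forest, and assign each edge to its parent end. The edges assigned
to one vertex form a star, and a star is crossing-free in every vertex order. With these stars as
pages, a vertex meets its own star and the stars of its three parents, hence four pages. For the
union bound, one forest is ordered without crossings and fills one page; each of the other two
splits, by the colour of the child in a proper 2-colouring, into two pages whose components are
stars, hence 1 + 2 + 2.

Planarity enters only through the absence of a `K₅` minor. This rests on
`exists_disjoint_edges_meet`, proved by lifting through the exponential map and counting modulo 4.

Graphs without `K₅` minor are covered by three forests by induction on the number of edges. If some
edge has at most two common neighbours of its ends, it is contracted and the forests are lifted back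
(`CoveredByThreeForests.of_contract`). Otherwise every edge lies in three triangles. Deleting one
edge and applying induction bounds the number of edges, so some non-isolated vertex has degree at
most five, and `hasK5Minor_of_degree_le_five` finds a forbidden minor around it. -/

/-! ### Continuous logarithms and plane drawings of `K₅` -/

/-- A nowhere vanishing continuous function on a square has a continuous logarithm. -/
theorem exists_continuous_log_square (f : unitInterval × unitInterval → ℂ) (hf : Continuous f)
    (h0 : ∀ p, f p ≠ 0) :
    ∃ L : unitInterval × unitInterval → ℂ, Continuous L ∧ ∀ p, Complex.exp (L p) = f p := by
  have cov := Complex.isCoveringMap_exp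
  let H : C(unitInterval × unitInterval, {z : ℂ // z ≠ 0}) :=
    ⟨fun p => ⟨f p, h0 p⟩, by fun_prop⟩
  -- One side of the square is lifted first; homotopy lifting extends the lift to the whole square.
  let b : C(unitInterval, {z : ℂ // z ≠ 0}) := ⟨fun t => H (0, t), by fun_prop⟩
  have hb : b 0 = ⟨_, Complex.exp_ne_zero (Complex.log (f (0, 0)))⟩ :=
    Subtype.ext (Complex.exp_log (h0 (0, 0))).symm
  let g := cov.liftPath b _ hb
  have hg : ∀ t, (⟨_, Complex.exp_ne_zero (g t)⟩ : {z : ℂ // z ≠ 0}) = b t :=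
    fun t => congrFun (cov.liftPath_lifts b _ hb) t
  refine ⟨cov.liftHomotopy H g fun t => (hg t).symm, map_continuous _, fun p => ?_⟩
  exact congrArg Subtype.val (congrFun (cov.liftHomotopy_lifts H g fun t => (hg t).symm) p)

/-- Two continuous logarithms of the same path have the same total variation. -/
theorem log_variation_unique {g h : unitInterval → ℂ} (hg : Continuous g) (hh : Continuous h)
    (heq : ∀ s, Complex.exp (g s) = Complex.exp (h s)) : g 1 - g 0 = h 1 - h 0 := by
  have key : g = fun s => h s + (g 0 - h 0) := by
    refine Complex.isCoveringMap_exp.eq_of_comp_eq hg (by fun_prop) ?_ 0 (by ring)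
    ext s
    simp only [Function.comp_apply]
    rw [Complex.exp_add, Complex.exp_sub, heq s, heq 0, div_self (Complex.exp_ne_zero _), mul_one]
  have := congrFun key 1
  rw [this]
  ring

/-- A choice of logarithms of the differences `c b - c a`, such that exchanging the two indices
changes the logarithm by `π * I`. -/
noncomputable def differenceLog {ι : Type*} [LinearOrder ι] (c : ι → ℂ) (a b : ι) : ℂ :=
  if a < b then Complex.log (c b - c a) else Complex.log (c a - c b) + Real.pi * Complex.I

theorem exp_differenceLog {ι : Type*} [LinearOrder ι] (c : ι → ℂ) (a b : ι)
    (h : c b - c a ≠ 0) : Complex.exp (differenceLog c a b) = c b - c a := by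
  unfold differenceLog
  split_ifs
  · exact Complex.exp_log h
  · rw [Complex.exp_add, Complex.exp_pi_mul_I, Complex.exp_log]
    · ring
    · intro h'
      exact h (by linear_combination -h')

theorem differenceLog_sub_swap {ι : Type*} [LinearOrder ι] (c : ι → ℂ) {a b : ι} (h : a ≠ b) :
    differenceLog c a b - differenceLog c b a
      = ((if a < b then -1 else 1 : ℤ) : ℂ) * (Real.pi * Complex.I) := by
  unfold differenceLog
  rcases lt_or_gt_of_ne h with h' | h'
  · simp [h', h'.not_gt]
  · simp [h', h'.not_gt]

/-- In every continuous drawing of the complete graph on five vertices in the plane, two edges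
without common endpoint meet. -/
theorem exists_disjoint_edges_meet (c : Fin 5 → ℂ) (γ : Fin 5 → Fin 5 → unitInterval → ℂ)
    (hcont : ∀ i j, i < j → Continuous (γ i j)) (h0 : ∀ i j, i < j → γ i j 0 = c i)
    (h1 : ∀ i j, i < j → γ i j 1 = c j) :
    ∃ i j k l, i < j ∧ k < l ∧ i ≠ k ∧ i ≠ l ∧ j ≠ k ∧ j ≠ l ∧ ∃ s t, γ i j s = γ k l t := by
  by_contra! hne
  -- The integer counts the full turns of the edge `i j` around `c v`, relative to the logarithms
  -- chosen at its ends. It is fixed before `g`, so it is the same for all continuous logarithms;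
  -- the value 0 is a default.
  have hn : ∀ v i j, ∃ n : ℤ, i < j → ∀ g : unitInterval → ℂ, Continuous g →
      (∀ s, Complex.exp (g s) = γ i j s - c v) →
      g 1 - g 0 = differenceLog c v j - differenceLog c v i + n * (2 * Real.pi * Complex.I) := by
    intro v i j
    by_cases hij : i < j
    swap
    · exact ⟨0, fun h => absurd h hij⟩
    by_cases hex : ∃ g : unitInterval → ℂ, Continuous g ∧ ∀ s, Complex.exp (g s) = γ i j s - c v
    swap
    · exact ⟨0, fun _ g hg hs => absurd ⟨g, hg, hs⟩ hex⟩
    obtain ⟨g, hg, hs⟩ := hex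
    have e0 := hs 0
    have e1 := hs 1
    rw [h0 i j hij] at e0
    rw [h1 i j hij] at e1
    have n0 : c i - c v ≠ 0 := e0 ▸ Complex.exp_ne_zero _
    have n1 : c j - c v ≠ 0 := e1 ▸ Complex.exp_ne_zero _
    rw [← exp_differenceLog c v i n0] at e0
    rw [← exp_differenceLog c v j n1] at e1
    obtain ⟨a, ha⟩ := Complex.exp_eq_exp_iff_exists_int.1 e0
    obtain ⟨b, hb⟩ := Complex.exp_eq_exp_iff_exists_int.1 e1
    refine ⟨b - a, fun _ g' hg' hs' => ?_⟩
    rw [log_variation_unique hg' hg fun s => (hs' s).trans (hs s).symm, ha, hb]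
    push_cast
    ring
  choose n hn using hn
  -- A logarithm of `γ i j s - γ k l t` has total variation zero around the boundary of the square.
  -- On each side one edge is seen from an end of the other. The `differenceLog` terms cancel at the
  -- corners up to `± π * I`, which leaves the four signs.
  have square : ∀ i j k l, i < j → k < l → i ≠ k → i ≠ l → j ≠ k → j ≠ l →
      2 * (n k i j + n j k l - n l i j - n i k l) + (if k < j then -1 else 1)
        + (if i < k then -1 else 1) + (if j < l then -1 else 1) + (if l < i then -1 else 1)
        = 0 := by
    intro i j k l hij hkl hik hil hjk hjl
    have c1 := hcont i j hij
    have c2 := hcont k l hkl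
    obtain ⟨L, hL, hexp⟩ := exists_continuous_log_square
      (fun p => γ i j p.1 - γ k l p.2) (by fun_prop)
      (fun p => sub_ne_zero.2 (hne i j k l hij hkl hik hil hjk hjl p.1 p.2))
    have e1 := hn k i j hij (fun s => L (s, 0)) (by fun_prop) fun s => by
      rw [hexp, h0 k l hkl]
    have e2 := hn l i j hij (fun s => L (s, 1)) (by fun_prop) fun s => by
      rw [hexp, h1 k l hkl]
    -- On this side and the next the difference appears with the opposite sign, which `π * I`
    -- corrects.
    have e3 := hn i k l hkl (fun t => L (0, t) + Real.pi * Complex.I) (by fun_prop) fun t => by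
      rw [Complex.exp_add, Complex.exp_pi_mul_I, hexp, h0 i j hij]; ring
    have e4 := hn j k l hkl (fun t => L (1, t) + Real.pi * Complex.I) (by fun_prop) fun t => by
      rw [Complex.exp_add, Complex.exp_pi_mul_I, hexp, h1 i j hij]; ring
    have d1 := differenceLog_sub_swap c hjk.symm
    have d2 := differenceLog_sub_swap c hik
    have d3 := differenceLog_sub_swap c hjl
    have d4 := differenceLog_sub_swap c hil.symm
    have hz : (Real.pi * Complex.I : ℂ) ≠ 0 :=
      mul_ne_zero (by exact_mod_cast Real.pi_ne_zero) Complex.I_ne_zero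
    have := mul_right_cancel₀ (a := ((2 * (n k i j + n j k l - n l i j - n i k l)
      + (if k < j then -1 else 1) + (if i < k then -1 else 1) + (if j < l then -1 else 1)
      + (if l < i then -1 else 1) : ℤ) : ℂ)) (c := 0) hz (by
        push_cast at d1 d2 d3 d4 ⊢
        linear_combination e2 + e3 - e1 - e4 - d1 - d2 - d3 - d4)
    exact_mod_cast this
  have q1 := square 0 1 2 3
  have q2 := square 0 2 1 3
  have q3 := square 0 3 1 2
  have q4 := square 0 1 2 4
  have q5 := square 0 2 1 4
  have q6 := square 0 4 1 2
  have q7 := square 0 1 3 4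
  have q8 := square 0 3 1 4
  have q9 := square 0 4 1 3
  have q10 := square 0 2 3 4
  have q11 := square 0 3 2 4
  have q12 := square 0 4 2 3
  have q13 := square 1 2 3 4
  have q14 := square 1 3 2 4
  have q15 := square 1 4 2 3
  -- Add the 15 equations modulo 4. Each `n v a b` occurs in exactly two of them, with coefficient
  -- `± 2`, so all these terms vanish. The four signs add up to 2 modulo 4 if the two pairs
  -- interleave and to 0 otherwise. Each 4-subset has one interleaving pair, so there are five, and
  -- the total is 2 modulo 4, a contradiction.
  simp +decide only [forall_const, if_true, if_false] at q1 q2 q3 q4 q5 q6 q7 q8 q9 q10 q11 q12 q13 q14 q15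
  clear square hn hne
  omega

/-! ### `K₅` minors and planarity -/

/-- The graph `G` has a minor on five pairwise adjacent vertices: there are five disjoint connected
branch sets, any two of which are joined by an edge. -/
def HasK5Minor {V : Type*} (G : SimpleGraph V) : Prop :=
  ∃ B : Fin 5 → Set V, (∀ i j, i ≠ j → Disjoint (B i) (B j)) ∧
    (∀ i, ∀ x ∈ B i, ∀ y ∈ B i, Relation.ReflTransGen (fun a b => G.Adj a b ∧ b ∈ B i) x y) ∧
    ∀ i j, i ≠ j → ∃ a ∈ B i, ∃ b ∈ B j, G.Adj a b

namespace PlaneDrawing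

variable {V : Type*} {G : SimpleGraph V}

/-- The part of the plane covered by the drawing of the subgraph induced on `S`. -/
def region (D : PlaneDrawing G) (S : Set V) : Set (EuclideanSpace ℝ (Fin 2)) :=
  {p | (∃ v ∈ S, D.point v = p) ∨ ∃ e : G.edgeSet, (∀ v ∈ e.1, v ∈ S) ∧ ∃ t, D.arc e t = p}

/-- A point on an arc is an endpoint of the edge or in the interior of the arc. -/
theorem arc_cases (D : PlaneDrawing G) (e : G.edgeSet) (t : unitInterval) :
    (∃ v ∈ e.1, D.point v = D.arc e t) ∨ t ∈ Set.Ioo (0 : unitInterval) 1 := by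
  have key : ∀ q ∈ s(D.arc e 0, D.arc e 1), ∃ v ∈ e.1, D.point v = q := by
    intro q hq
    rw [D.arc_endpoints e] at hq
    exact Sym2.mem_map.1 hq
  rcases eq_or_ne t 0 with rfl | h0
  · exact Or.inl (key _ (Sym2.mem_mk_left _ _))
  rcases eq_or_ne t 1 with rfl | h1
  · exact Or.inl (key _ (Sym2.mem_mk_right _ _))
  · exact Or.inr ⟨unitInterval.pos_iff_ne_zero.2 h0, unitInterval.lt_one_iff_ne_one.2 h1⟩

theorem region_cases (D : PlaneDrawing G) {S : Set V} {p : EuclideanSpace ℝ (Fin 2)}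
    (hp : p ∈ D.region S) : (∃ v ∈ S, D.point v = p) ∨
      ∃ e : G.edgeSet, (∀ v ∈ e.1, v ∈ S) ∧ ∃ t ∈ Set.Ioo (0 : unitInterval) 1, D.arc e t = p := by
  rcases hp with h | ⟨e, he, t, rfl⟩
  · exact Or.inl h
  · rcases D.arc_cases e t with ⟨v, hv, h⟩ | h
    · exact Or.inl ⟨v, he v hv, h⟩
    · exact Or.inr ⟨e, he, t, h, rfl⟩

/-- Regions can share only a drawn vertex or an interior point of a single arc, and then a vertex
lies in both sets. -/
theorem disjoint_region (D : PlaneDrawing G) {S T : Set V} (h : Disjoint S T) :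
    Disjoint (D.region S) (D.region T) := by
  rw [Set.disjoint_left] at h ⊢
  intro p hS hT
  rcases D.region_cases hS with ⟨v, hv, rfl⟩ | ⟨e, he, s, hs, rfl⟩
  · rcases D.region_cases hT with ⟨w, hw, hvw⟩ | ⟨f, hf, t, ht, hft⟩
    · exact h hv (D.point_injective hvw ▸ hw)
    · exact D.arc_ne_point f t ht v hft
  · rcases D.region_cases hT with ⟨w, hw, hvw⟩ | ⟨f, hf, t, ht, hft⟩
    · exact D.arc_ne_point e s hs w hvw.symm
    · refine D.arc_ne_arc e f ?_ s hs t ht hft.symm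
      rintro rfl
      have hv := Sym2.out_fst_mem e.1
      exact h (he _ hv) (hf _ hv)

theorem joinedIn_of_adj (D : PlaneDrawing G) {S : Set V} {a b : V} (hab : G.Adj a b)
    (ha : a ∈ S) (hb : b ∈ S) : JoinedIn (D.region S) (D.point a) (D.point b) := by
  let e : G.edgeSet := ⟨s(a, b), hab⟩
  have hj : JoinedIn (D.region S) (D.arc e 0) (D.arc e 1) := by
    refine ⟨⟨⟨D.arc e, D.arc_continuous e⟩, rfl, rfl⟩, fun t => Or.inr ⟨e, ?_, t, rfl⟩⟩
    intro v hv
    rcases Sym2.mem_iff.1 hv with rfl | rfl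
    exacts [ha, hb]
  have he : s(D.arc e 0, D.arc e 1) = s(D.point a, D.point b) := D.arc_endpoints e
  rcases Sym2.eq_iff.1 he with ⟨h0, h1⟩ | ⟨h0, h1⟩
  · rwa [h0, h1] at hj
  · rw [h0, h1] at hj
    exact hj.symm

theorem joinedIn_of_reflTransGen (D : PlaneDrawing G) {S B : Set V} (hBS : B ⊆ S) {x y : V}
    (hx : x ∈ B) (h : Relation.ReflTransGen (fun a b => G.Adj a b ∧ b ∈ B) x y) :
    JoinedIn (D.region S) (D.point x) (D.point y) ∧ y ∈ B := by
  induction h with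
  | refl => exact ⟨JoinedIn.refl (Or.inl ⟨x, hBS hx, rfl⟩), hx⟩
  | tail _ h ih => exact ⟨ih.1.trans (D.joinedIn_of_adj h.1 (hBS ih.2) (hBS h.2)), h.2⟩

end PlaneDrawing

/-- One vertex from each branch set and paths through pairs of branch sets give a drawing of `K₅`.
Edges of `K₅` without common end run through disjoint regions, so they cannot meet. -/
theorem IsPlanar.not_hasK5Minor {V : Type*} {G : SimpleGraph V} (hG : IsPlanar G) :
    ¬ HasK5Minor G := by
  obtain ⟨D⟩ := hG
  rintro ⟨B, hdisj, hconn, hadj⟩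
  have hne : ∀ i, ∃ x, x ∈ B i := fun i => by
    obtain ⟨j, hj⟩ := exists_ne i
    obtain ⟨a, ha, -⟩ := hadj i j hj.symm
    exact ⟨a, ha⟩
  choose c hc using hne
  have hjoin : ∀ i j, i < j →
      JoinedIn (D.region (B i ∪ B j)) (D.point (c i)) (D.point (c j)) := by
    intro i j hij
    obtain ⟨a, ha, b, hb, hab⟩ := hadj i j hij.ne
    exact ((D.joinedIn_of_reflTransGen Set.subset_union_left (hc i) (hconn i _ (hc i) a ha)).1.trans
      (D.joinedIn_of_adj hab (Or.inl ha) (Or.inr hb))).trans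
      (D.joinedIn_of_reflTransGen Set.subset_union_right hb (hconn j b hb _ (hc j))).1
  let φ : EuclideanSpace ℝ (Fin 2) → ℂ := fun p => ⟨p 0, p 1⟩
  have hφ : Continuous φ := by
    have : φ = fun p => (p 0 : ℂ) + (p 1 : ℂ) * Complex.I := by
      funext p
      apply Complex.ext <;> simp [φ]
    rw [this]
    fun_prop
  have hinj : Function.Injective φ := by
    intro p q hpq
    have h0 : p 0 = q 0 := congrArg Complex.re hpq
    have h1 : p 1 = q 1 := congrArg Complex.im hpq
    ext i
    fin_cases i
    exacts [h0, h1]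
  obtain ⟨i, j, k, l, hij, hkl, hik, hil, hjk, hjl, s, t, hst⟩ := exists_disjoint_edges_meet
    (fun i => φ (D.point (c i)))
    (fun i j => if h : i < j then φ ∘ (hjoin i j h).somePath else 0)
    (fun i j h => by
      simp only [h, dite_true]
      exact hφ.comp (hjoin i j h).somePath.continuous)
    (fun i j h => by simp [h]) (fun i j h => by simp [h])
  simp only [hij, hkl, dite_true, Function.comp_apply] at hst
  have hd : Disjoint (B i ∪ B j) (B k ∪ B l) := by
    simp only [Set.disjoint_union_left, Set.disjoint_union_right]
    exact ⟨⟨hdisj i k hik, hdisj j k hjk⟩, hdisj i l hil, hdisj j l hjl⟩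
  refine Set.disjoint_left.1 (D.disjoint_region hd) ((hjoin i j hij).somePath_mem s) ?_
  rw [hinj hst]
  exact (hjoin k l hkl).somePath_mem t

/-! ### Finite forests -/

namespace SimpleGraph.IsAcyclic

variable {V : Type*}

/-- A finite acyclic graph with an edge has a leaf. -/
theorem exists_leaf [Finite V] {F : SimpleGraph V} (hF : F.IsAcyclic) {a b : V} (hab : F.Adj a b) :
    ∃ x y, F.Adj x y ∧ ∀ z, F.Adj x z → z = y := by
  have : Nonempty V := ⟨a⟩
  obtain ⟨u, v, p, hp, hmax⟩ := Walk.exists_isPath_forall_isPath_length_le_length F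
  have hlen := hmax _ _ (Walk.cons hab Walk.nil) (by simp [hab.ne])
  have hnil : ¬ p.Nil := by
    intro h
    rw [Walk.length_eq_zero_iff.2 h] at hlen
    simp at hlen
  -- The start of a longest path is a leaf: a neighbour off the path would extend it, and one on the
  -- path must be the second vertex.
  refine ⟨u, p.snd, p.adj_snd hnil, fun w hadj => hF.eq_snd_of_adj_start hp hadj ?_⟩
  by_contra hw
  have := hmax _ _ (p.cons hadj.symm) (hp.cons hw)
  simp at this

/-- Every finite acyclic graph arises from the edgeless graph by attaching leaves. -/
@[elab_as_elim]
theorem leaf_induction [Finite V] {P : SimpleGraph V → Prop} (bot : P ⊥)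
    (leaf : ∀ F x y, (∀ z, ¬ F.Adj x z) → x ≠ y → P F → P (F ⊔ edge x y)) {F : SimpleGraph V}
    (hF : F.IsAcyclic) : P F := by
  induction hn : F.edgeSet.ncard using Nat.strong_induction_on generalizing F with
  | _ n ih =>
    by_cases hE : ∃ a b, F.Adj a b
    · obtain ⟨a, b, hab⟩ := hE
      obtain ⟨x, y, hxy, hleaf⟩ := hF.exists_leaf hab
      have hsup : F.deleteEdges {s(x, y)} ⊔ edge x y = F := by
        ext c d
        simp only [sup_adj, deleteEdges_adj, Set.mem_singleton_iff, edge_adj, Sym2.eq_iff]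
        constructor
        · rintro (h | ⟨⟨rfl, rfl⟩ | ⟨rfl, rfl⟩, -⟩)
          exacts [h.1, hxy, hxy.symm]
        · intro h
          by_cases h' : c = x ∧ d = y ∨ c = y ∧ d = x
          · exact Or.inr ⟨h', h.ne⟩
          · exact Or.inl ⟨h, h'⟩
      rw [← hsup]
      refine leaf _ x y (fun z hz => ?_) hxy.ne
        (ih _ ?_ (hF.anti (deleteEdges_le _)) rfl)
      · rw [deleteEdges_adj] at hz
        rw [hleaf z hz.1] at hz
        exact hz.2 rfl
      · rw [← hn, edgeSet_deleteEdges]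
        exact Set.ncard_lt_ncard ⟨Set.sdiff_subset, fun h => (h hxy).2 rfl⟩
    · have : F = ⊥ := by
        ext c d
        simp only [bot_adj, iff_false]
        exact fun h => hE ⟨c, d, h⟩
      rwa [this]

/-- A finite acyclic graph has a proper 2-colouring and a choice of parents such that every edge
joins a vertex to its parent. -/
theorem exists_parent_coloring [Finite V] {F : SimpleGraph V} (hF : F.IsAcyclic) :
    ∃ (par : V → V) (col : V → Bool), ∀ a b, F.Adj a b →
      col a ≠ col b ∧ (par a = b ∨ par b = a) := by
  classical
  refine leaf_induction ?_ (fun F x y hx hxy ih => ?_) hF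
  · exact ⟨id, fun _ => true, fun a b h => h.elim⟩
  · obtain ⟨par, col, h⟩ := ih
    refine ⟨Function.update par x y, Function.update col x (! col y), fun a b hab => ?_⟩
    rw [sup_adj, edge_adj] at hab
    rcases hab with hab | ⟨⟨rfl, rfl⟩ | ⟨rfl, rfl⟩, -⟩
    · have ha : a ≠ x := fun h => hx b (h ▸ hab)
      have hb : b ≠ x := fun h => hx a (h ▸ hab.symm)
      simpa [ha, hb] using h a b hab
    · simp [hxy.symm]
    · simp [hxy.symm]

/-- A finite acyclic graph has a crossing-free vertex ordering. -/
theorem exists_crossing_free_order [Finite V] {F : SimpleGraph V} (hF : F.IsAcyclic) :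
    ∃ f : V → ℚ, Function.Injective f ∧ ∀ a b c d, F.Adj a b → F.Adj c d →
      ¬ (f a < f c ∧ f c < f b ∧ f b < f d) := by
  classical
  refine leaf_induction ?_ (fun F x y hx hxy ih => ?_) hF
  · obtain ⟨n, ⟨e⟩⟩ := Finite.exists_equiv_fin V
    refine ⟨fun v => ((e v : ℕ) : ℚ), fun v w h => ?_, fun a b c d h => h.elim⟩
    exact e.injective (Fin.ext (Nat.cast_injective h))
  · obtain ⟨f, hinj, hcf⟩ := ih
    -- The new leaf is placed directly after its neighbour `y`, with no vertex in between, so the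
    -- new edge crosses nothing. Rational positions always leave room.
    obtain ⟨q, hq, hgap⟩ : ∃ q, f y < q ∧ ∀ z, ¬ (f y < f z ∧ f z ≤ q) := by
      have h : ∀ z, ∀ᶠ q in nhdsWithin (f y) (Set.Ioi (f y)), ¬ (f y < f z ∧ f z ≤ q) := by
        intro z
        by_cases hz : f y < f z
        · filter_upwards [nhdsWithin_le_nhds (Iio_mem_nhds hz)] with q hq h
          exact absurd h.2 (not_le.2 hq)
        · exact Filter.Eventually.of_forall fun q h => hz h.1
      obtain ⟨q, h1, h2⟩ := (eventually_mem_nhdsWithin.and (Filter.eventually_all.2 h)).exists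
      exact ⟨q, h1, h2⟩
    have hne : ∀ z, f z ≠ q := fun z hz => hgap z ⟨hz ▸ hq, hz.le⟩
    let f' := Function.update f x q
    have hx' : f' x = q := Function.update_self ..
    have hf' : ∀ z, z ≠ x → f' z = f z := fun z hz => Function.update_of_ne hz ..
    have hgap' : ∀ z, ¬ (f y < f' z ∧ f' z < q) := by
      intro z hz
      by_cases hzx : z = x
      · rw [hzx, hx'] at hz
        exact lt_irrefl _ hz.2
      · rw [hf' z hzx] at hz
        exact hgap z ⟨hz.1, hz.2.le⟩
    have hy' : f' y = f y := hf' y hxy.symm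
    refine ⟨f', fun v w h => ?_, fun a b c d hab hcd h => ?_⟩
    · by_cases hv : v = x <;> by_cases hw : w = x
      · rw [hv, hw]
      · rw [hv, hx', hf' w hw] at h
        exact absurd h.symm (hne w)
      · rw [hw, hx', hf' v hv] at h
        exact absurd h (hne v)
      · rw [hf' v hv, hf' w hw] at h
        exact hinj h
    · have old : ∀ {a b}, F.Adj a b → a ≠ x := fun h e => hx _ (e ▸ h)
      rw [sup_adj, edge_adj] at hab hcd
      rcases hab with hab | ⟨⟨rfl, rfl⟩ | ⟨rfl, rfl⟩, -⟩
      · rcases hcd with hcd | ⟨⟨rfl, rfl⟩ | ⟨rfl, rfl⟩, -⟩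
        · rw [hf' a (old hab), hf' b (old hab.symm), hf' c (old hcd), hf' d (old hcd.symm)] at h
          exact hcf a b c d hab hcd h
        · rw [hx', hy'] at h
          exact absurd (h.2.1.trans h.2.2) hq.not_gt
        · rw [hx', hy'] at h
          exact hgap' b h.2
      · rw [hx', hy'] at h
        exact absurd (h.1.trans h.2.1) hq.not_gt
      · rw [hx', hy'] at h
        exact hgap' c ⟨h.1, h.2.1⟩

/-- An acyclic graph whose edges lie in a nonempty set `S` of vertices has fewer than `#S` edges. -/
theorem ncard_edgeSet_lt [Finite V] {F : SimpleGraph V} (hF : F.IsAcyclic) (S : Finset V)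
    (hS : S.Nonempty) (hFS : ∀ a b, F.Adj a b → a ∈ S) : F.edgeSet.ncard < S.card := by
  classical
  revert S
  refine leaf_induction ?_ (fun F x y hx hxy ih => ?_) hF
  · intro S hS _
    simpa using hS
  · intro S hS hFS
    have hxS : x ∈ S := hFS x y (by simp [edge_adj, hxy])
    have hyS : y ∈ S := hFS y x (by simp [edge_adj, hxy.symm])
    have h := ih (S.erase x) ⟨y, Finset.mem_erase.2 ⟨hxy.symm, hyS⟩⟩ fun a b hab =>
      Finset.mem_erase.2 ⟨fun h => hx b (h ▸ hab), hFS a b (Or.inl hab)⟩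
    rw [Finset.card_erase_of_mem hxS] at h
    have hle : (F ⊔ edge x y).edgeSet.ncard ≤ F.edgeSet.ncard + 1 := by
      rw [edgeSet_sup]
      refine (Set.ncard_union_le _ _).trans (Nat.add_le_add_left ?_ _)
      refine (Set.ncard_le_ncard (t := {s(x, y)}) ?_).trans (Set.ncard_singleton _).le
      rintro ⟨c, d⟩ h
      exact Sym2.eq_iff.2 ((edge_adj ..).1 h).1
    omega

end SimpleGraph.IsAcyclic

/-! ### Contracting an edge -/

namespace SimpleGraph

variable {V : Type*}

/-- The map that identifies `v` with `u`. -/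
noncomputable def collapse (u v x : V) : V :=
  open scoped Classical in if x = v then u else x

theorem collapse_self (u v : V) : collapse u v v = u := by simp [collapse]

theorem collapse_of_ne {u v x : V} (h : x ≠ v) : collapse u v x = x := by simp [collapse, h]

theorem collapse_left (u v : V) : collapse u v u = u := by simp [collapse]

theorem collapse_cases (u v x : V) : x = v ∧ collapse u v x = u ∨ x ≠ v ∧ collapse u v x = x := by
  by_cases h : x = v
  · exact Or.inl ⟨h, h ▸ collapse_self u v⟩
  · exact Or.inr ⟨h, collapse_of_ne h⟩

/-- The graph in which the vertices `u` and `v` are merged into `u`; the vertex `v` is kept as an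
isolated vertex. -/
noncomputable def contract (G : SimpleGraph V) (u v : V) : SimpleGraph V where
  Adj a b := a ≠ b ∧ ∃ a' b', G.Adj a' b' ∧ collapse u v a' = a ∧ collapse u v b' = b
  symm := ⟨fun _ _ ⟨h, a', b', h1, h2, h3⟩ => ⟨h.symm, b', a', h1.symm, h3, h2⟩⟩
  loopless := ⟨fun _ h => h.1 rfl⟩

theorem ncard_edgeSet_contract_lt [Finite V] {G : SimpleGraph V} {u v : V} (huv : G.Adj u v) :
    (G.contract u v).edgeSet.ncard < G.edgeSet.ncard := by
  have hsub : (G.contract u v).edgeSet ⊆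
      Sym2.map (collapse u v) '' (G.edgeSet \ {s(u, v)}) := by
    rintro ⟨a, b⟩ ⟨hne, a', b', hadj, rfl, rfl⟩
    refine ⟨s(a', b'), ⟨hadj, fun h => hne ?_⟩, rfl⟩
    rcases Sym2.eq_iff.1 h with ⟨rfl, rfl⟩ | ⟨rfl, rfl⟩
    · rw [collapse_self, collapse_left]
    · rw [collapse_self, collapse_left]
  calc (G.contract u v).edgeSet.ncard
      ≤ (G.edgeSet \ {s(u, v)}).ncard := (Set.ncard_le_ncard hsub).trans (Set.ncard_image_le)
    _ < G.edgeSet.ncard := Set.ncard_lt_ncard ⟨Set.sdiff_subset, fun h => (h huv).2 rfl⟩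

end SimpleGraph

open SimpleGraph in
-- The branch sets are pulled back along `collapse`. They stay connected because the only nontrivial
-- fibre is joined by the edge `u v`.
theorem HasK5Minor.of_contract {V : Type*} {G : SimpleGraph V} {u v : V} (huv : G.Adj u v)
    (h : HasK5Minor (G.contract u v)) : HasK5Minor G := by
  obtain ⟨B, hdisj, hconn, hadj⟩ := h
  have fiber : ∀ i x y, collapse u v x = collapse u v y → collapse u v x ∈ B i →
      Relation.ReflTransGen (fun a b => G.Adj a b ∧ collapse u v b ∈ B i) x y := by
    intro i x y hxy hx
    rcases eq_or_ne x y with rfl | hne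
    · exact .refl
    · have hG : G.Adj x y := by
        rcases collapse_cases u v x with ⟨h, h1⟩ | ⟨h, h1⟩ <;>
        rcases collapse_cases u v y with ⟨h', h2⟩ | ⟨h', h2⟩ <;> rw [h1, h2] at hxy
        · exact absurd (h.trans h'.symm) hne
        · exact h ▸ hxy ▸ huv.symm
        · exact h' ▸ hxy ▸ huv
        · exact absurd hxy hne
      exact .single ⟨hG, hxy ▸ hx⟩
  refine ⟨fun i => collapse u v ⁻¹' B i, fun i j hij => (hdisj i j hij).preimage _, ?_, ?_⟩
  · intro i x hx y hy
    have key : ∀ w, Relation.ReflTransGen (fun a b => (G.contract u v).Adj a b ∧ b ∈ B i)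
        (collapse u v x) w → ∀ y, collapse u v y = w →
        Relation.ReflTransGen (fun a b => G.Adj a b ∧ collapse u v b ∈ B i) x y := by
      intro w hw
      induction hw with
      | refl => exact fun y hy => fiber i x y hy.symm hx
      | tail _ hst ih =>
        intro y hy
        obtain ⟨⟨-, a', b', hG, ha, hb⟩, hB⟩ := hst
        exact ((ih a' ha).tail ⟨hG, by rwa [hb]⟩).trans
          (fiber i b' y (hb.trans hy.symm) (by rwa [hb]))
    exact key _ (hconn i _ hx _ hy) y rfl
  · intro i j hij
    obtain ⟨_, ha, _, hb, -, a', b', hG, rfl, rfl⟩ := hadj i j hij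
    exact ⟨a', ha, b', hb, hG⟩

theorem HasK5Minor.mono {V : Type*} {G H : SimpleGraph V} (hGH : G ≤ H) (h : HasK5Minor G) :
    HasK5Minor H := by
  obtain ⟨B, hdisj, hconn, hadj⟩ := h
  refine ⟨B, hdisj, fun i x hx y hy => Relation.ReflTransGen.mono
    (fun a b h => ⟨hGH h.1, h.2⟩) x y (hconn i x hx y hy), ?_⟩
  intro i j hij
  obtain ⟨a, ha, b, hb, hab⟩ := hadj i j hij
  exact ⟨a, ha, b, hb, hGH hab⟩

/-! ### Lifting three forests through a contraction -/

namespace SimpleGraph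

variable {V : Type*}

/-- Split the vertex `u` of `T` into `u` and `v`, where the edge from `u` to `x` becomes an edge
from `r x` to `x`. -/
noncomputable def split (T : SimpleGraph V) (u v : V) (r : V → V) : SimpleGraph V where
  Adj a b := T.Adj (collapse u v a) (collapse u v b) ∧
    (a = u ∨ a = v → a = r b) ∧ (b = u ∨ b = v → b = r a)
  symm := ⟨fun _ _ h => ⟨h.1.symm, h.2.2, h.2.1⟩⟩
  loopless := ⟨fun _ h => T.loopless.irrefl _ h.1⟩

theorem split_adj_left {T : SimpleGraph V} {u v x : V} {r : V → V} (hxu : x ≠ u) (hxv : x ≠ v)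
    (h : T.Adj u x) (hr : r x = u) : (T.split u v r).Adj u x := by
  refine ⟨?_, fun _ => hr.symm, fun h => ?_⟩
  · rwa [collapse_left, collapse_of_ne hxv]
  · exact absurd h (by simp [hxu, hxv])

theorem split_adj_right {T : SimpleGraph V} {u v x : V} {r : V → V} (hxu : x ≠ u) (hxv : x ≠ v)
    (h : T.Adj u x) (hr : r x = v) : (T.split u v r).Adj v x := by
  refine ⟨?_, fun _ => hr.symm, fun h => ?_⟩
  · rwa [collapse_self, collapse_of_ne hxv]
  · exact absurd h (by simp [hxu, hxv])

theorem split_adj_of_ne {T : SimpleGraph V} {u v a b : V} {r : V → V} (hau : a ≠ u) (hav : a ≠ v)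
    (hbu : b ≠ u) (hbv : b ≠ v) (h : T.Adj a b) : (T.split u v r).Adj a b := by
  refine ⟨?_, fun h => ?_, fun h => ?_⟩
  · rwa [collapse_of_ne hav, collapse_of_ne hbv]
  · exact absurd h (by simp [hau, hav])
  · exact absurd h (by simp [hbu, hbv])

/-- An edge of `T` at `u` has at most one lift, since `r` decides which of `u` and `v` carries it.
-/
theorem split_adj_injective {T : SimpleGraph V} {u v a b c d : V} {r : V → V}
    (hab : (T.split u v r).Adj a b) (hcd : (T.split u v r).Adj c d)
    (hac : collapse u v a = collapse u v c) (hbd : collapse u v b = collapse u v d) :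
    a = c ∧ b = d := by
  have key : ∀ {x y : V}, collapse u v x = collapse u v y → x = y ∨
      (x = u ∨ x = v) ∧ (y = u ∨ y = v) := by
    intro x y h
    rcases collapse_cases u v x with ⟨h1, h1'⟩ | ⟨h1, h1'⟩ <;>
    rcases collapse_cases u v y with ⟨h2, h2'⟩ | ⟨h2, h2'⟩ <;> rw [h1', h2'] at h
    · exact Or.inl (h1.trans h2.symm)
    · exact Or.inr ⟨Or.inr h1, Or.inl h.symm⟩
    · exact Or.inr ⟨Or.inl h, Or.inr h2⟩
    · exact Or.inl h
  obtain ⟨h1, h2, h3⟩ := hab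
  obtain ⟨h4, h5, h6⟩ := hcd
  rcases key hac with rfl | ⟨ha, hc⟩ <;> rcases key hbd with rfl | ⟨hb, hd⟩
  · exact ⟨rfl, rfl⟩
  · exact ⟨rfl, (h3 hb).trans (h6 hd).symm⟩
  · exact ⟨(h2 ha).trans (h5 hc).symm, rfl⟩
  · refine absurd h1 ?_
    have : ∀ {x : V}, x = u ∨ x = v → collapse u v x = u := by
      rintro x (rfl | rfl)
      exacts [collapse_left _ _, collapse_self _ _]
    rw [this ha, this hb]
    exact T.loopless.irrefl u

/-- Every edge of the forest `T` is a bridge, and `collapse` maps a walk avoiding `s(a, b)` to one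
avoiding the image edge. Only the images of `x` and `y` matter, which gives more than acyclicity of
the split graph. -/
theorem IsAcyclic.not_reachable_split_deleteEdges {T : SimpleGraph V} (hT : T.IsAcyclic)
    {u v a b x y : V} {r : V → V} (hab : (T.split u v r).Adj a b)
    (hx : collapse u v x = collapse u v a) (hy : collapse u v y = collapse u v b) :
    ¬ ((T.split u v r).deleteEdges {s(a, b)}).Reachable x y := by
  intro h
  let φ : (T.split u v r).deleteEdges {s(a, b)} →g
      T.deleteEdges {s(collapse u v a, collapse u v b)} :=
    { toFun := collapse u v
      map_rel' := by
        intro c d hcd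
        rw [deleteEdges_adj] at hcd ⊢
        refine ⟨hcd.1.1, fun h => hcd.2 ?_⟩
        rcases Sym2.eq_iff.1 h with ⟨h1, h2⟩ | ⟨h1, h2⟩
        · obtain ⟨rfl, rfl⟩ := split_adj_injective hcd.1 hab h1 h2
          rfl
        · obtain ⟨rfl, rfl⟩ := split_adj_injective hcd.1 hab.symm h1 h2
          exact Sym2.eq_swap }
  have h' := h.map φ
  change (T.deleteEdges _).Reachable (collapse u v x) (collapse u v y) at h'
  rw [hx, hy] at h'
  exact isBridge_iff.1 (isAcyclic_iff_forall_adj_isBridge.1 hT hab.1) h'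

theorem IsAcyclic.split {T : SimpleGraph V} (hT : T.IsAcyclic) (u v : V) (r : V → V) :
    (T.split u v r).IsAcyclic :=
  isAcyclic_iff_forall_adj_isBridge.2 fun _ _ hab =>
    isBridge_iff.2 (hT.not_reachable_split_deleteEdges hab rfl rfl)

/-- A path from `u` to `v` would use its first edge only once, and the rest would lead back to the
other copy of `u`. Hence a split forest has room for one more edge. -/
theorem IsAcyclic.not_reachable_split {T : SimpleGraph V} (hT : T.IsAcyclic) {u v : V}
    (huv : u ≠ v) (r : V → V) : ¬ (T.split u v r).Reachable u v := by
  intro h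
  obtain ⟨p, hp⟩ := h.exists_isPath
  cases p with
  | nil => exact huv rfl
  | @cons _ z _ hz p =>
    rw [Walk.cons_isPath_iff] at hp
    refine hT.not_reachable_split_deleteEdges hz.symm (x := z) (y := v) rfl
      ((collapse_self u v).trans (collapse_left u v).symm) ?_
    refine ⟨p.toDeleteEdges _ fun e he => ?_⟩
    rintro rfl
    exact hp.2 (p.snd_mem_support_of_mem_edges he)

/-- The graph `G` is the union of (at most) three forests. -/
def CoveredByThreeForests (G : SimpleGraph V) : Prop :=
  ∃ T : Fin 3 → SimpleGraph V, (∀ i, (T i).IsAcyclic) ∧ ∀ a b, G.Adj a b → ∃ i, (T i).Adj a b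

/-- Each split forest receives one extra edge from `p i` to `q i`, between different components. A
private neighbour of `u` or `v` keeps its single edge; a common neighbour needs two edges where the
contraction has one. -/
theorem coveredByThreeForests_of_split {G : SimpleGraph V} {u v : V} (huv : G.Adj u v)
    {T : Fin 3 → SimpleGraph V} (hT : ∀ i, (T i).IsAcyclic)
    (hcov : ∀ a b, (G.contract u v).Adj a b → ∃ i, (T i).Adj a b) (r : Fin 3 → V → V)
    (p q : Fin 3 → V) (hnr : ∀ i, ¬ ((T i).split u v (r i)).Reachable (p i) (q i))
    (hpq : ∃ i, p i = u ∧ q i = v)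
    (hu : ∀ x, x ≠ u → x ≠ v → G.Adj u x → ¬ G.Adj v x → ∀ i, r i x = u)
    (hv : ∀ x, x ≠ u → x ≠ v → G.Adj v x → ¬ G.Adj u x → ∀ i, r i x = v)
    (hcu : ∀ x, G.Adj u x → G.Adj v x →
      ∃ i, ((T i).Adj u x ∧ r i x = u) ∨ (p i = u ∧ q i = x))
    (hcv : ∀ x, G.Adj u x → G.Adj v x →
      ∃ i, ((T i).Adj u x ∧ r i x = v) ∨ (p i = v ∧ q i = x)) :
    G.CoveredByThreeForests := by
  have hedge : ∀ i a b, a ≠ b → p i = a → q i = b → (edge (p i) (q i)).Adj a b := by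
    rintro i a b hab rfl rfl
    exact (edge_adj ..).2 ⟨Or.inl ⟨rfl, rfl⟩, hab⟩
  have adj_u : ∀ x, x ≠ u → x ≠ v → G.Adj u x →
      ∃ i, ((T i).split u v (r i) ⊔ edge (p i) (q i)).Adj u x := by
    intro x hxu hxv h
    by_cases hvx : G.Adj v x
    · obtain ⟨i, ⟨h1, h2⟩ | ⟨h1, h2⟩⟩ := hcu x h hvx
      · exact ⟨i, Or.inl (split_adj_left hxu hxv h1 h2)⟩
      · exact ⟨i, Or.inr (hedge i u x hxu.symm h1 h2)⟩
    · obtain ⟨i, hi⟩ := hcov u x ⟨hxu.symm, u, x, h, collapse_left u v, collapse_of_ne hxv⟩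
      exact ⟨i, Or.inl (split_adj_left hxu hxv hi (hu x hxu hxv h hvx i))⟩
  have adj_v : ∀ x, x ≠ u → x ≠ v → G.Adj v x →
      ∃ i, ((T i).split u v (r i) ⊔ edge (p i) (q i)).Adj v x := by
    intro x hxu hxv h
    by_cases hux : G.Adj u x
    · obtain ⟨i, ⟨h1, h2⟩ | ⟨h1, h2⟩⟩ := hcv x hux h
      · exact ⟨i, Or.inl (split_adj_right hxu hxv h1 h2)⟩
      · exact ⟨i, Or.inr (hedge i v x hxv.symm h1 h2)⟩
    · obtain ⟨i, hi⟩ := hcov u x ⟨hxu.symm, v, x, h, collapse_self u v, collapse_of_ne hxv⟩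
      exact ⟨i, Or.inl (split_adj_right hxu hxv hi (hv x hxu hxv h hux i))⟩
  have adj_uv : ∃ i, ((T i).split u v (r i) ⊔ edge (p i) (q i)).Adj u v := by
    obtain ⟨i, h1, h2⟩ := hpq
    exact ⟨i, Or.inr (hedge i u v huv.ne h1 h2)⟩
  have swap : ∀ {a b}, (∃ i, ((T i).split u v (r i) ⊔ edge (p i) (q i)).Adj a b) →
      ∃ i, ((T i).split u v (r i) ⊔ edge (p i) (q i)).Adj b a := fun ⟨i, h⟩ => ⟨i, h.symm⟩
  refine ⟨fun i => (T i).split u v (r i) ⊔ edge (p i) (q i),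
    fun i => ((hT i).split u v (r i)).sup_edge_of_not_reachable (hnr i), fun a b hab => ?_⟩
  by_cases hau : a = u
  · subst hau
    by_cases hbv : b = v
    · exact hbv ▸ adj_uv
    · exact adj_u b hab.ne.symm hbv hab
  by_cases hav : a = v
  · subst hav
    by_cases hbu : b = u
    · exact hbu ▸ swap adj_uv
    · exact adj_v b hbu hab.ne.symm hab
  by_cases hbu : b = u
  · subst hbu
    exact swap (adj_u a hau hav hab.symm)
  by_cases hbv : b = v
  · subst hbv
    exact swap (adj_v a hau hav hab.symm)
  obtain ⟨i, hi⟩ := hcov a b ⟨hab.ne, a, b, hab, collapse_of_ne hav, collapse_of_ne hbv⟩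
  exact ⟨i, Or.inl (split_adj_of_ne hau hav hbu hbv hi)⟩

/-- If the contraction of an edge with at most two common neighbours of its ends is the union of
three forests, then so is the graph. -/
theorem CoveredByThreeForests.of_contract [Finite V] {G : SimpleGraph V} {u v : V}
    (huv : G.Adj u v) (hcommon : {x | G.Adj u x ∧ G.Adj v x}.ncard ≤ 2)
    (h : (G.contract u v).CoveredByThreeForests) : G.CoveredByThreeForests := by
  classical
  obtain ⟨T, hT, hcov⟩ := h
  have hC : ∀ x, G.Adj u x → G.Adj v x → ∃ k, (T k).Adj u x := fun x hux hvx =>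
    hcov u x ⟨hux.ne, u, x, hux, collapse_left u v, collapse_of_ne hvx.ne.symm⟩
  -- Common neighbours are attached to `u`. What is missing is `u v` and one edge from `v` to each
  -- common neighbour: at most three edges, one per forest.
  let r : V → V := fun x => if G.Adj u x then u else v
  have hru : ∀ x, G.Adj u x → r x = u := fun x h => if_pos h
  have hrv : ∀ x, ¬ G.Adj u x → r x = v := fun x h => if_neg h
  have hnr : ∀ i r, ¬ ((T i).split u v r).Reachable u v :=
    fun i r => (hT i).not_reachable_split huv.ne r
  have hnv : ∀ k x, G.Adj u x → G.Adj v x → (T k).Adj u x →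
      ¬ ((T k).split u v r).Reachable v x := fun k x hux hvx hk hre =>
    hnr k r ((split_adj_left hux.ne.symm hvx.ne.symm hk (hru x hux)).reachable.trans hre.symm)
  have third : ∀ k l : Fin 3, ∃ c, c ≠ k ∧ c ≠ l := by decide
  have hcases : {x | G.Adj u x ∧ G.Adj v x}.ncard = 0 ∨ {x | G.Adj u x ∧ G.Adj v x}.ncard = 1 ∨
      {x | G.Adj u x ∧ G.Adj v x}.ncard = 2 := by omega
  rcases hcases with h0 | h1 | h2
  · have hno : ∀ x, G.Adj u x → ¬ G.Adj v x := fun x hu hv => by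
      have := (Set.ncard_eq_zero).1 h0 ▸ (show x ∈ {x | G.Adj u x ∧ G.Adj v x} from ⟨hu, hv⟩)
      exact this
    exact coveredByThreeForests_of_split huv hT hcov (fun _ => r) (fun _ => u) (fun _ => v)
      (fun i => hnr i r) ⟨0, rfl, rfl⟩ (fun x _ _ h _ _ => hru x h) (fun x _ _ _ h _ => hrv x h)
      (fun x h h' => absurd h' (hno x h)) (fun x h h' => absurd h' (hno x h))
  · obtain ⟨x, hx⟩ := Set.ncard_eq_one.1 h1
    have hmem : ∀ y, G.Adj u y ∧ G.Adj v y ↔ y = x := fun y => by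
      simpa using congrArg (y ∈ ·) hx
    obtain ⟨hux, hvx⟩ := (hmem x).2 rfl
    obtain ⟨k, hk⟩ := hC x hux hvx
    obtain ⟨c, hck, -⟩ := third k k
    refine coveredByThreeForests_of_split huv hT hcov (fun _ => r)
      (fun i => if i = k then v else u) (fun i => if i = k then x else v) (fun i => ?_)
      ⟨c, if_neg hck, if_neg hck⟩ (fun x _ _ h _ _ => hru x h) (fun x _ _ _ h _ => hrv x h)
      (fun y h h' => ?_) (fun y h h' => ?_)
    · by_cases hik : i = k
      · subst hik
        simpa using hnv i x hux hvx hk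
      · simpa [hik] using hnr i r
    · obtain rfl := (hmem y).1 ⟨h, h'⟩
      exact ⟨k, Or.inl ⟨hk, hru y h⟩⟩
    · obtain rfl := (hmem y).1 ⟨h, h'⟩
      exact ⟨k, Or.inr ⟨if_pos rfl, if_pos rfl⟩⟩
  · obtain ⟨x, y, hxy, hxy'⟩ := Set.ncard_eq_two.1 h2
    have hmem : ∀ z, G.Adj u z ∧ G.Adj v z ↔ z = x ∨ z = y := fun z => by
      simpa using congrArg (z ∈ ·) hxy'
    obtain ⟨hux, hvx⟩ := (hmem x).2 (Or.inl rfl)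
    obtain ⟨huy, hvy⟩ := (hmem y).2 (Or.inr rfl)
    obtain ⟨k, hk⟩ := hC x hux hvx
    obtain ⟨l, hl⟩ := hC y huy hvy
    -- Forest `k` contains `u x` and can take `v x`; forest `b` is to serve `y`, and the remaining
    -- forest `c` takes `u v`.
    obtain ⟨b, hbk, hby⟩ : ∃ b, b ≠ k ∧ (¬ ((T b).split u v r).Reachable v y ∨ (T k).Adj u y) := by
      by_cases hkl : l = k
      · obtain ⟨b, hb, -⟩ := third k k
        exact ⟨b, hb, Or.inr (hkl ▸ hl)⟩
      · exact ⟨l, hkl, Or.inl (hnv l y huy hvy hl)⟩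
    obtain ⟨c, hck, hcb⟩ := third k b
    -- If `v` and `y` are already connected in forest `b`, then `u` and `y` are not. In that case
    -- forest `k` carries `v y` instead of `u y`, and `b` takes `u y`.
    by_cases hre : ((T b).split u v r).Reachable v y
    · have hky : (T k).Adj u y := hby.resolve_left fun h => h hre
      have hre' : ¬ ((T b).split u v r).Reachable u y := fun h => hnr b r (h.trans hre.symm)
      let r' : Fin 3 → V → V := fun i => if i = k then Function.update r y v else r
      have hr' : ∀ i z, z ≠ y → r' i z = r z := by
        intro i z hz
        by_cases hik : i = k <;> simp [r', hik, hz]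
      have hrk : r' k y = v := by simp [r']
      refine coveredByThreeForests_of_split huv hT hcov r'
        (fun i => if i = k then v else u) (fun i => if i = k then x else if i = b then y else v)
        (fun i => ?_) ⟨c, if_neg hck, by simp [hck, hcb]⟩
        (fun z _ _ h h' i => ?_) (fun z _ _ h h' i => ?_)
        (fun z h h' => ?_) (fun z h h' => ?_)
      · by_cases hik : i = k
        · subst hik
          simp only [if_true]
          intro hre
          exact hnr i (r' i) ((split_adj_left hux.ne.symm hvx.ne.symm hk
            ((hr' i x hxy).trans (hru x hux))).reachable.trans hre.symm)
        · by_cases hib : i = b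
          · subst hib
            simpa [hik, r'] using hre'
          · simpa [hik, hib] using hnr i (r' i)
      · rw [hr' i z fun e => h' (e ▸ hvy), hru z h]
      · rw [hr' i z fun e => h' (e ▸ huy), hrv z h']
      · rcases (hmem z).1 ⟨h, h'⟩ with rfl | rfl
        · exact ⟨k, Or.inl ⟨hk, (hr' k z hxy).trans (hru z h)⟩⟩
        · exact ⟨b, Or.inr ⟨by simp [hbk], by simp [hbk]⟩⟩
      · rcases (hmem z).1 ⟨h, h'⟩ with rfl | rfl
        · exact ⟨k, Or.inr ⟨by simp, by simp⟩⟩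
        · exact ⟨k, Or.inl ⟨hky, hrk⟩⟩
    · refine coveredByThreeForests_of_split huv hT hcov (fun _ => r)
        (fun i => if i = k ∨ i = b then v else u)
        (fun i => if i = k then x else if i = b then y else v)
        (fun i => ?_) ⟨c, by simp [hck, hcb], by simp [hck, hcb]⟩
        (fun z _ _ h _ _ => hru z h) (fun z _ _ _ h _ => hrv z h)
        (fun z h h' => ?_) (fun z h h' => ?_)
      · by_cases hik : i = k
        · subst hik
          simpa using hnv i x hux hvx hk
        · by_cases hib : i = b
          · subst hib
            simpa [hik] using hre
          · simpa [hik, hib] using hnr i r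
      · obtain ⟨j, hj⟩ := hC z h h'
        exact ⟨j, Or.inl ⟨hj, hru z h⟩⟩
      · rcases (hmem z).1 ⟨h, h'⟩ with rfl | rfl
        · exact ⟨k, Or.inr ⟨by simp, by simp⟩⟩
        · exact ⟨b, Or.inr ⟨by simp, by simp [hbk]⟩⟩

end SimpleGraph

/-! ### `K₅` minors around a vertex of small degree -/

/-- The branch sets are `{z}`, `{a, a'}`, `{b}`, `{d}`, `{e}`. Allowing `a = a'` covers both a `K₅`
subgraph and the contraction of one edge. -/
theorem hasK5Minor_of_adj {V : Type*} {G : SimpleGraph V} {z a a' b d e : V}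
    (hza' : z ≠ a') (ha : a = a' ∨ G.Adj a a') (hab : a ≠ b) (hab' : a' ≠ b) (had : a ≠ d)
    (had' : a' ≠ d) (hae : a ≠ e) (hae' : a' ≠ e) (za : G.Adj z a) (zb : G.Adj z b)
    (zd : G.Adj z d) (ze : G.Adj z e) (bd : G.Adj b d) (be : G.Adj b e) (de : G.Adj d e)
    (ab : G.Adj a b ∨ G.Adj a' b) (ad : G.Adj a d ∨ G.Adj a' d) (ae : G.Adj a e ∨ G.Adj a' e) :
    HasK5Minor G := by
  have hlt : ∀ R : Fin 5 → Fin 5 → Prop, (∀ i j, R i j → R j i) → R 0 1 → R 0 2 → R 0 3 →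
      R 0 4 → R 1 2 → R 1 3 → R 1 4 → R 2 3 → R 2 4 → R 3 4 → ∀ i j, i ≠ j → R i j := by
    intro R hs h01 h02 h03 h04 h12 h13 h14 h23 h24 h34 i j hij
    fin_cases i <;> fin_cases j <;> first | exact absurd rfl hij | assumption | (apply hs; assumption)
  refine ⟨![{z}, {a, a'}, {b}, {d}, {e}], ?_, ?_, ?_⟩
  · refine hlt _ (fun i j h => Disjoint.symm h) ?_ ?_ ?_ ?_ ?_ ?_ ?_ ?_ ?_ ?_ <;>
      simp [za.ne, zb.ne, zd.ne, ze.ne, hza', bd.ne, be.ne, de.ne,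
        hab.symm, hab'.symm, had.symm, had'.symm, hae.symm, hae'.symm]
  · have single : ∀ w : V, ∀ x ∈ ({w} : Set V), ∀ y ∈ ({w} : Set V),
        Relation.ReflTransGen (fun a b => G.Adj a b ∧ b ∈ ({w} : Set V)) x y := by
      rintro w x rfl y rfl
      exact .refl
    have pair : ∀ x ∈ ({a, a'} : Set V), ∀ y ∈ ({a, a'} : Set V),
        Relation.ReflTransGen (fun p q => G.Adj p q ∧ q ∈ ({a, a'} : Set V)) x y := by
      rcases ha with rfl | ha
      · simp only [Set.pair_eq_singleton]
        exact single a
      · rintro x (rfl | rfl) y (rfl | rfl)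
        · exact .refl
        · exact .single ⟨ha, by simp⟩
        · exact .single ⟨ha.symm, by simp⟩
        · exact .refl
    intro i
    fin_cases i
    exacts [single z, pair, single b, single d, single e]
  · refine hlt _ (fun i j ⟨x, hx, y, hy, h⟩ => ⟨y, hy, x, hx, h.symm⟩)
      ?_ ?_ ?_ ?_ ?_ ?_ ?_ ?_ ?_ ?_ <;>
      simp [za, zb, zd, ze, bd, be, de, ab, ad, ae]

open SimpleGraph in
/-- A vertex of degree at most five all of whose incident edges lie in at least three triangles
forms, together with its neighbours, a `K₅` minor. -/
theorem hasK5Minor_of_degree_le_five {V : Type*} {G : SimpleGraph V} (z : V) (N : Finset V)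
    (hN : ∀ x, x ∈ N ↔ G.Adj z x) (hne : N.Nonempty) (hcard : N.card ≤ 5)
    (hdeg : ∀ x, G.Adj z x → 3 ≤ {y | G.Adj z y ∧ G.Adj x y}.ncard) : HasK5Minor G := by
  classical
  have hfilter : ∀ x ∈ N, (N.filter fun y => ¬ G.Adj x y).card + 3 ≤ N.card := by
    intro x hx
    have h3 := hdeg x ((hN x).1 hx)
    have : {y | G.Adj z y ∧ G.Adj x y} = ((N.filter fun y => G.Adj x y : Finset V) : Set V) := by
      ext y
      simp [hN]
    rw [this, Set.ncard_coe_finset] at h3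
    have := Finset.card_filter_add_card_filter_not (s := N) (fun y => G.Adj x y)
    omega
  -- By `hfilter`, at most two vertices of `N`, one of them `x` itself, are not adjacent to `x`. So
  -- non-adjacency is a matching on `N`.
  have hadj : ∀ x ∈ N, ∀ y ∈ N, ∀ w ∈ N, x ≠ y → x ≠ w → y ≠ w → ¬ G.Adj x y → G.Adj x w := by
    intro x hx y hy w hw hxy hxw hyw hnxy
    by_contra hnxw
    have hsub : ({x, y, w} : Finset V) ⊆ N.filter fun y => ¬ G.Adj x y := by
      intro t ht
      simp only [Finset.mem_insert, Finset.mem_singleton] at ht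
      rcases ht with rfl | rfl | rfl
      exacts [Finset.mem_filter.2 ⟨hx, G.loopless.irrefl _⟩, Finset.mem_filter.2 ⟨hy, hnxy⟩,
        Finset.mem_filter.2 ⟨hw, hnxw⟩]
    have h1 := Finset.card_le_card hsub
    rw [Finset.card_eq_three.2 ⟨x, y, w, hxy, hxw, hyw, rfl⟩] at h1
    have h2 := hfilter x hx
    omega
  have hz : ∀ x ∈ N, G.Adj z x := fun x hx => (hN x).1 hx
  have clique : ∀ a ∈ N, ∀ b ∈ N, ∀ d ∈ N, ∀ e ∈ N, G.Adj a b → G.Adj a d → G.Adj a e →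
      G.Adj b d → G.Adj b e → G.Adj d e → HasK5Minor G := fun a ha b hb d hd e he ab ad ae bd be de =>
    hasK5Minor_of_adj (hz a ha).ne (Or.inl rfl) ab.ne ab.ne ad.ne ad.ne ae.ne ae.ne (hz a ha)
      (hz b hb) (hz d hd) (hz e he) bd be de (Or.inl ab) (Or.inl ad) (Or.inl ae)
  by_cases hcl : ∀ x ∈ N, ∀ y ∈ N, x ≠ y → G.Adj x y
  · obtain ⟨a, ha⟩ := hne
    have h1 := hfilter a ha
    have h2 : 0 < (N.filter fun y => ¬ G.Adj a y).card :=
      Finset.card_pos.2 ⟨a, by simp [ha]⟩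
    have h3 : 2 < (N.erase a).card := by
      rw [Finset.card_erase_of_mem ha]
      omega
    obtain ⟨b, hb, d, hd, e, he, hbd, hbe, hde⟩ := Finset.two_lt_card.1 h3
    rw [Finset.mem_erase] at hb hd he
    exact clique a ha b hb.2 d hd.2 e he.2 (hcl _ ha _ hb.2 hb.1.symm) (hcl _ ha _ hd.2 hd.1.symm)
      (hcl _ ha _ he.2 he.1.symm) (hcl _ hb.2 _ hd.2 hbd) (hcl _ hb.2 _ he.2 hbe)
      (hcl _ hd.2 _ he.2 hde)
  · push Not at hcl
    obtain ⟨a, ha, b, hb, hab, hnab⟩ := hcl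
    have h1 := hfilter a ha
    have h2 : 2 ≤ (N.filter fun y => ¬ G.Adj a y).card := by
      rw [← Finset.card_pair hab]
      refine Finset.card_le_card fun t ht => ?_
      simp only [Finset.mem_insert, Finset.mem_singleton] at ht
      rcases ht with rfl | rfl
      exacts [Finset.mem_filter.2 ⟨ha, G.loopless.irrefl _⟩, Finset.mem_filter.2 ⟨hb, hnab⟩]
    -- A missing edge `a b` forces `N` to have five vertices, and the other three are adjacent to
    -- both `a` and `b`.
    have h3 : 2 < ((N.erase a).erase b).card := by
      rw [Finset.card_erase_of_mem (Finset.mem_erase.2 ⟨hab.symm, hb⟩),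
        Finset.card_erase_of_mem ha]
      omega
    obtain ⟨c, hc, d, hd, e, he, hcd, hce, hde⟩ := Finset.two_lt_card.1 h3
    simp only [Finset.mem_erase] at hc hd he
    have hax : ∀ x, x ≠ b ∧ x ≠ a ∧ x ∈ N → G.Adj a x := fun x hx =>
      hadj a ha b hb x hx.2.2 hab hx.2.1.symm hx.1.symm hnab
    have hbx : ∀ x, x ≠ b ∧ x ≠ a ∧ x ∈ N → G.Adj b x := fun x hx =>
      hadj b hb a ha x hx.2.2 hab.symm hx.1.symm hx.2.1.symm fun h => hnab h.symm
    -- If `p q` is missing too, merge `a` with `p`: `p` reaches `b`, and `a` reaches `q` and `t`.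
    have merge : ∀ p q t, (p ≠ b ∧ p ≠ a ∧ p ∈ N) → (q ≠ b ∧ q ≠ a ∧ q ∈ N) →
        (t ≠ b ∧ t ≠ a ∧ t ∈ N) → p ≠ q → p ≠ t → q ≠ t → ¬ G.Adj p q → HasK5Minor G := by
      intro p q t hp hq ht hpq hpt hqt hnpq
      have hqt' : G.Adj q t := hadj q hq.2.2 p hp.2.2 t ht.2.2 hpq.symm hqt hpt
        fun h => hnpq h.symm
      exact hasK5Minor_of_adj (hz p hp.2.2).ne (Or.inr (hax p hp)) hab hp.1 hq.2.1.symm hpq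
        ht.2.1.symm hpt (hz a ha) (hz b hb) (hz q hq.2.2) (hz t ht.2.2) (hbx q hq) (hbx t ht) hqt'
        (Or.inr (hbx p hp).symm) (Or.inl (hax q hq)) (Or.inl (hax t ht))
    by_cases h1 : G.Adj c d
    · by_cases h2 : G.Adj c e
      · by_cases h3 : G.Adj d e
        · exact clique a ha c hc.2.2 d hd.2.2 e he.2.2 (hax c hc) (hax d hd) (hax e he) h1 h2 h3
        · exact merge d e c hd he hc hde hcd.symm hce.symm h3
      · exact merge c e d hc he hd hce hcd hde.symm h2
    · exact merge c d e hc hd he hcd hce hde h1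

/-! ### Three forests in graphs without `K₅` minor -/

namespace SimpleGraph

variable {V : Type*}

/-- A graph that is the union of three forests, up to one edge, has a non-isolated vertex of degree
at most five. -/
theorem exists_degree_le_five [Fintype V] {G : SimpleGraph V} [DecidableRel G.Adj] {s t : V}
    (hst : G.Adj s t) (h : (G.deleteEdges {s(s, t)}).CoveredByThreeForests) :
    ∃ z, 0 < G.degree z ∧ G.degree z ≤ 5 := by
  classical
  obtain ⟨T, hT, hcov⟩ := h
  by_contra! hdeg
  let S : Finset V := Finset.univ.filter fun a => 0 < G.degree a
  have hS : ∀ {a b}, G.Adj a b → a ∈ S := fun {a b} h =>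
    Finset.mem_filter.2 ⟨Finset.mem_univ _, (G.degree_pos_iff_exists_adj a).2 ⟨b, h⟩⟩
  have hforest : ∀ i, (T i ⊓ G).edgeSet.ncard < S.card := fun i =>
    ((hT i).anti inf_le_left).ncard_edgeSet_lt S ⟨s, hS hst⟩ fun a b h => hS h.2
  have hsub : G.edgeSet ⊆ {s(s, t)} ∪ ((T 0 ⊓ G).edgeSet ∪ ((T 1 ⊓ G).edgeSet ∪
      (T 2 ⊓ G).edgeSet)) := by
    rintro ⟨a, b⟩ hab
    by_cases he : s(a, b) = s(s, t)
    · exact Or.inl he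
    · obtain ⟨i, hi⟩ := hcov a b (deleteEdges_adj.2 ⟨hab, he⟩)
      refine Or.inr ?_
      fin_cases i
      · exact Or.inl ⟨hi, hab⟩
      · exact Or.inr (Or.inl ⟨hi, hab⟩)
      · exact Or.inr (Or.inr ⟨hi, hab⟩)
  -- Three forests on `S` have at most `3 * (#S - 1)` edges, and the deleted edge adds one. Degrees
  -- of at least six on `S` would require `3 * #S` edges.
  have hcard : G.edgeSet.ncard + 2 ≤ 3 * S.card := by
    have h1 := Set.ncard_le_ncard hsub
    have h2 := Set.ncard_union_le {s(s, t)} ((T 0 ⊓ G).edgeSet ∪ ((T 1 ⊓ G).edgeSet ∪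
      (T 2 ⊓ G).edgeSet))
    have h3 := Set.ncard_union_le (T 0 ⊓ G).edgeSet ((T 1 ⊓ G).edgeSet ∪ (T 2 ⊓ G).edgeSet)
    have h4 := Set.ncard_union_le (T 1 ⊓ G).edgeSet (T 2 ⊓ G).edgeSet
    have h5 := Set.ncard_singleton s(s, t)
    have := hforest 0
    have := hforest 1
    have := hforest 2
    omega
  have hsum : S.card * 6 ≤ ∑ v, G.degree v :=
    (Finset.card_nsmul_le_sum S _ 6 fun v hv => hdeg v (Finset.mem_filter.1 hv).2).trans
      (Finset.sum_le_sum_of_subset (Finset.subset_univ S))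
  rw [G.sum_degrees_eq_twice_card_edges, ← Set.ncard_coe_finset G.edgeFinset,
    coe_edgeFinset] at hsum
  omega

/-- A finite graph without `K₅` minor is the union of three forests. -/
theorem coveredByThreeForests_of_not_hasK5Minor [Finite V] {G : SimpleGraph V}
    (hG : ¬ HasK5Minor G) : G.CoveredByThreeForests := by
  classical
  have := Fintype.ofFinite V
  induction hn : G.edgeSet.ncard using Nat.strong_induction_on generalizing G with
  | _ n ih =>
    by_cases hfew : ∃ u v, G.Adj u v ∧ {x | G.Adj u x ∧ G.Adj v x}.ncard ≤ 2
    · obtain ⟨u, v, huv, hcommon⟩ := hfew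
      exact .of_contract huv hcommon
        (ih _ (hn ▸ ncard_edgeSet_contract_lt huv) (fun h => hG (h.of_contract huv)) rfl)
    -- Now every edge lies in at least three triangles. The induction hypothesis for `G` minus an
    -- edge serves only to find a vertex of small degree.
    push Not at hfew
    by_cases hE : ∃ s t, G.Adj s t
    · obtain ⟨s, t, hst⟩ := hE
      have hlt : (G.deleteEdges {s(s, t)}).edgeSet.ncard < n := by
        rw [← hn, edgeSet_deleteEdges]
        exact Set.ncard_lt_ncard ⟨Set.sdiff_subset, fun h => (h hst).2 rfl⟩
      obtain ⟨z, hpos, hle⟩ := exists_degree_le_five hst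
        (ih _ hlt (fun h => hG (h.mono (deleteEdges_le _))) rfl)
      exact absurd (hasK5Minor_of_degree_le_five z (G.neighborFinset z) (by simp)
        (Finset.card_pos.1 hpos) hle fun x hx => hfew z x hx) hG
    · exact ⟨fun _ => ⊥, fun _ => isAcyclic_bot, fun a b hab => absurd ⟨a, b, hab⟩ hE⟩

end SimpleGraph

/-! ### Pages from three forests -/

/-- The partition of the edges of a finite graph into the nonempty colour classes of a colouring. -/
theorem exists_finpartition_of_coloring {V K : Type*} [Finite V] (G : SimpleGraph V)
    (κ : Sym2 V → K) : ∃ P : Finpartition (G.edgeSet : Set (Sym2 V)),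
      ∀ A, A ∈ P.parts ↔ A.Nonempty ∧ ∃ k, A = {e | e ∈ G.edgeSet ∧ κ e = k} := by
  let parts := (Set.toFinite {A : Set (Sym2 V) | A.Nonempty ∧
    ∃ k, A = {e | e ∈ G.edgeSet ∧ κ e = k}}).toFinset
  have hparts : ∀ A, A ∈ parts ↔ A.Nonempty ∧ ∃ k, A = {e | e ∈ G.edgeSet ∧ κ e = k} := by
    simp [parts]
  refine ⟨⟨parts, ?_, ?_, ?_⟩, hparts⟩
  · rw [Finset.supIndep_iff_pairwiseDisjoint]
    intro A hA B hB hne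
    obtain ⟨-, k, rfl⟩ := (hparts A).1 hA
    obtain ⟨-, l, rfl⟩ := (hparts B).1 hB
    refine Set.disjoint_left.2 fun e he he' => hne ?_
    rw [← he.2, ← he'.2]
  · rw [Finset.sup_id_set_eq_sUnion]
    ext e
    rw [Set.mem_sUnion]
    constructor
    · rintro ⟨A, hA, he⟩
      obtain ⟨-, k, rfl⟩ := (hparts A).1 hA
      exact he.1
    · intro he
      exact ⟨{e' | e' ∈ G.edgeSet ∧ κ e' = κ e}, (hparts _).2 ⟨⟨e, he, rfl⟩, _, rfl⟩, he, rfl⟩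
  · intro h
    exact Set.not_nonempty_empty ((hparts _).1 h).1

/-- Crossing edges have four distinct ends, so a star is crossing-free whatever the spine. -/
theorem crossingFree_of_common_vertex {V : Type*} (spine : LinearOrder V) {F : Set (Sym2 V)}
    (c : V) (h : ∀ e ∈ F, c ∈ e) : CrossingFree spine F := by
  rintro u v x y huv hxy ⟨h1, h2, h3⟩
  have hc := Sym2.mem_iff.1 (h _ huv)
  have hc' := Sym2.mem_iff.1 (h _ hxy)
  rcases hc with rfl | rfl <;> rcases hc' with rfl | rfl
  · exact lt_irrefl _ h1
  · exact lt_irrefl _ (h1.trans (h2.trans h3))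
  · exact lt_irrefl _ h2
  · exact lt_irrefl _ h3

namespace SimpleGraph.CoveredByThreeForests

variable {V : Type*}

/-- Each edge of a union of three forests can be assigned to one of the forests and oriented to the
parent of one of its ends in that forest. -/
theorem exists_orientation [Finite V] {G : SimpleGraph V} (h : G.CoveredByThreeForests) :
    ∃ (f : V → ℚ) (idx : Sym2 V → Fin 3) (ch : Sym2 V → V) (par : Fin 3 → V → V)
      (col : Fin 3 → V → Bool), Function.Injective f ∧
      (∀ a b c d, G.Adj a b → G.Adj c d → idx s(a, b) = 0 → idx s(c, d) = 0 →
        ¬ (f a < f c ∧ f c < f b ∧ f b < f d)) ∧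
      ∀ e ∈ G.edgeSet, e = s(ch e, par (idx e) (ch e)) ∧
        col (idx e) (par (idx e) (ch e)) ≠ col (idx e) (ch e) := by
  classical
  obtain ⟨T, hT, hcov⟩ := h
  -- A spine can be fitted to one forest only; the other two will be cut into stars.
  obtain ⟨f, hinj, hf⟩ := (hT 0).exists_crossing_free_order
  choose par col hpc using fun i => (hT i).exists_parent_coloring
  have hidx : ∀ e, ∃ i, e ∈ G.edgeSet → e ∈ (T i).edgeSet := by
    rintro ⟨a, b⟩
    by_cases hab : G.Adj a b
    · obtain ⟨i, hi⟩ := hcov a b hab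
      exact ⟨i, fun _ => hi⟩
    · exact ⟨0, fun h => absurd h hab⟩
  choose idx hidx using hidx
  have hch : ∀ e, ∃ x, e ∈ G.edgeSet → e = s(x, par (idx e) x) ∧
      col (idx e) (par (idx e) x) ≠ col (idx e) x := by
    rintro ⟨a, b⟩
    by_cases hab : G.Adj a b
    · obtain ⟨hne, h | h⟩ := hpc (idx s(a, b)) a b (hidx s(a, b) hab)
      · refine ⟨a, fun _ => ?_⟩
        change s(a, b) = s(a, par (idx s(a, b)) a) ∧
          col (idx s(a, b)) (par (idx s(a, b)) a) ≠ col (idx s(a, b)) a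
        rw [h]
        exact ⟨rfl, hne.symm⟩
      · refine ⟨b, fun _ => ?_⟩
        change s(a, b) = s(b, par (idx s(a, b)) b) ∧
          col (idx s(a, b)) (par (idx s(a, b)) b) ≠ col (idx s(a, b)) b
        rw [h]
        exact ⟨Sym2.eq_swap, hne⟩
    · exact ⟨a, fun h => absurd h hab⟩
  choose ch hch using hch
  refine ⟨f, idx, ch, par, col, hinj, fun a b c d hab hcd h0 h0' => ?_, hch⟩
  have hab' := hidx s(a, b) hab
  have hcd' := hidx s(c, d) hcd
  rw [h0] at hab'
  rw [h0'] at hcd'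
  exact hf a b c d hab' hcd'

/-- The page of an edge is its parent end, regardless of the forest. A vertex lies in its own star
and, as a child, in at most one star per forest. -/
theorem localPageNumber_le_four [Finite V] {G : SimpleGraph V} (h : G.CoveredByThreeForests) :
    localPageNumber G ≤ 4 := by
  classical
  obtain ⟨f, idx, ch, par, col, hinj, -, hch⟩ := h.exists_orientation
  let κ : Sym2 V → V := fun e => par (idx e) (ch e)
  obtain ⟨P, hP⟩ := exists_finpartition_of_coloring G κ
  let L : LinearEmbedding G := ⟨LinearOrder.lift' f hinj, P⟩
  have hstar : ∀ e ∈ G.edgeSet, κ e ∈ e := by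
    intro e he
    have := Sym2.mem_mk_right (ch e) (κ e)
    rwa [← (hch e he).1] at this
  refine iInf₂_le_of_le 4 ⟨L, fun A hA => ?_, fun v => ?_⟩ le_rfl
  · obtain ⟨-, k, rfl⟩ := (hP A).1 hA
    refine crossingFree_of_common_vertex _ k ?_
    rintro e ⟨he, rfl⟩
    exact hstar e he
  · let C : Finset V := {v, par 0 v, par 1 v, par 2 v}
    have hsub : L.pagesAt v ⊆ (fun k => {e | e ∈ G.edgeSet ∧ κ e = k}) '' (C : Set V) := by
      rintro A ⟨hA, e, he, hv⟩
      obtain ⟨-, k, rfl⟩ := (hP A).1 hA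
      refine ⟨k, ?_, rfl⟩
      obtain ⟨heG, rfl⟩ := he
      rw [(hch e heG).1, Sym2.mem_iff] at hv
      rcases hv with rfl | hv
      · have : ∀ i, par i (ch e) ∈ ({ch e, par 0 (ch e), par 1 (ch e), par 2 (ch e)} : Finset V) := by
          intro i
          fin_cases i <;> simp
        exact this _
      · simp [C, κ, ← hv]
    calc (L.pagesAt v).encard ≤ (C : Set V).encard :=
          (Set.encard_le_encard hsub).trans (Set.encard_image_le _ _)
      _ = (C.card : ℕ∞) := Set.encard_coe_eq_coe_finsetCard C
      _ ≤ ((4 : ℕ) : ℕ∞) := by exact_mod_cast Finset.card_le_four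

/-- Forest 0 is one page. In the other forests a page fixes the colour of the child, so no vertex is
both child and parent there, and the components are stars. -/
theorem unionPageNumber_le_five [Finite V] {G : SimpleGraph V} (h : G.CoveredByThreeForests) :
    unionPageNumber G ≤ 5 := by
  classical
  obtain ⟨f, idx, ch, par, col, hinj, hcf, hch⟩ := h.exists_orientation
  let κ : Sym2 V → Fin 3 × Bool := fun e =>
    if idx e = 0 then (0, false) else (idx e, col (idx e) (ch e))
  obtain ⟨P, hP⟩ := exists_finpartition_of_coloring G κ
  let L : LinearEmbedding G := ⟨LinearOrder.lift' f hinj, P⟩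
  have hcard : P.parts.card ≤ 5 := by
    -- Forest 0 uses only the label `(0, false)`, which leaves five of the six labels.
    have hsub : P.parts ⊆ (Finset.univ.filter fun k : Fin 3 × Bool => k ≠ (0, true)).image
        fun k => {e | e ∈ G.edgeSet ∧ κ e = k} := by
      intro A hA
      obtain ⟨⟨e, he⟩, k, rfl⟩ := (hP A).1 hA
      refine Finset.mem_image.2 ⟨k, ?_, rfl⟩
      obtain ⟨-, rfl⟩ := he
      simp only [Finset.mem_filter, Finset.mem_univ, true_and, κ]
      split_ifs with h0
      · simp
      · exact fun h => h0 (congrArg Prod.fst h)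
    exact (Finset.card_le_card hsub).trans (Finset.card_image_le.trans (by decide))
  refine iInf₂_le_of_le P.parts.card ⟨L, fun A hA C => ?_, rfl⟩ (by exact_mod_cast hcard)
  obtain ⟨-, ⟨i, β⟩, rfl⟩ := (hP A).1 hA
  by_cases hi : i = 0
  · subst hi
    have hzero : ∀ e, κ e = (0, β) → idx e = 0 := by
      intro e he
      by_contra h0
      simp only [κ, h0, if_false] at he
      exact h0 (congrArg Prod.fst he)
    intro u v x y huv hxy
    exact hcf u v x y huv.1.1 hxy.1.1 (hzero _ huv.1.2) (hzero _ hxy.1.2)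
  · have hclass : ∀ e, κ e = (i, β) → idx e = i ∧ col i (ch e) = β := by
      intro e he
      by_cases h0 : idx e = 0
      · simp only [κ, h0, if_true] at he
        exact absurd (congrArg Prod.fst he).symm hi
      · simp only [κ, h0, if_false] at he
        obtain rfl : idx e = i := congrArg Prod.fst he
        exact ⟨rfl, congrArg Prod.snd he⟩
    -- In this page the vertices of colour `β` are children and the others are centres. The function
    -- is constant along edges, hence on components.
    let center : V → V := fun x => if col i x = β then par i x else x
    have hcenter : ∀ e ∈ G.edgeSet, κ e = (i, β) → ∀ x ∈ e, center x = par i (ch e) := by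
      intro e he hκ x hx
      obtain ⟨rfl, rfl⟩ := hclass e hκ
      obtain ⟨h1, h2⟩ := hch e he
      rw [h1, Sym2.mem_iff] at hx
      rcases hx with rfl | rfl
      · simp [center]
      · simp only [center, h2, if_false]
    induction C using SimpleGraph.ConnectedComponent.ind with
    | _ w =>
    have hconst : ∀ x y, (SimpleGraph.fromEdgeSet
        {e | e ∈ G.edgeSet ∧ κ e = (i, β)}).Reachable x y → center x = center y := by
      rintro x y ⟨p⟩
      induction p with
      | nil => rfl
      | @cons x y z h _ ih =>
        obtain ⟨⟨he, hκ⟩, -⟩ := (SimpleGraph.fromEdgeSet_adj _).1 h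
        rw [← ih, hcenter _ he hκ x (Sym2.mem_mk_left _ _),
          hcenter _ he hκ y (Sym2.mem_mk_right _ _)]
    refine crossingFree_of_common_vertex _ (center w) ?_
    rintro e ⟨⟨he, hκ⟩, hC⟩
    have hmem : ch e ∈ e := by
      have := Sym2.mem_mk_left (ch e) (par (idx e) (ch e))
      rwa [← (hch e he).1] at this
    have hmem' : par i (ch e) ∈ e := by
      have := Sym2.mem_mk_right (ch e) (par (idx e) (ch e))
      rwa [← (hch e he).1, (hclass e hκ).1] at this
    rw [← hconst _ _ (SimpleGraph.ConnectedComponent.exact (hC _ hmem)),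
      hcenter e he hκ _ hmem]
    exact hmem'

end SimpleGraph.CoveredByThreeForests

theorem corollary1 {V : Type*} [Finite V] (G : SimpleGraph V) (hG : IsPlanar G) :
    localPageNumber G ≤ 4 ∧ unionPageNumber G ≤ 5 :=
  have h := SimpleGraph.coveredByThreeForests_of_not_hasK5Minor hG.not_hasK5Minor
  ⟨h.localPageNumber_le_four, h.unionPageNumber_le_five⟩
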